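/- All fields have characteristic $0$. Let $(F,\sigma)$ be a difference field, i.e. a field with an automorphism, let $F(x)$ be the rational function field, and let $(F(x),\sigma)$ be a $\Pi\Sigma$-field extension of $(F,\sigma)$: $\sigma$ extends to an automorphism of $F(x)$ with $\sigma(x)/x\in F^*$ or $\sigma(x)-x\in F$, and every $c\in F(x)$ with $\sigma(c)=c$ lies in $F$. **Periods and $x$-degrees.** The period of $h\in F(x)^*$ is the least $n\ge 1$ with $\sigma^n(h)/h\in F$, and $0$ if there is no such $n$. A nonzero $h\in F(x)$ has $x$-degree $\le d$ ($d\in\mathbb N$) if every irreducible period $0$ factor of its numerator or denominator has degree $\le d$ in $x$. Irreducible $a,b\in F[x]$ are $\sigma$-coprime if $\sigma^k(a)/b\notin F$ for all $k\in\mathbb Z$. A $(d,x)$-set is a finite set of monic irreducible polynomials in $F[x]$ of degree $>d$ and of period $0$ that are pairwise $\sigma$-coprime. **Simple $R\Pi\Sigma$-extensions.** Let $A_0=F(x)$, and for $1\le i\le e$ let $A_i=A_{i-1}\langle t_i\rangle$ be one of the following: $A_{i-1}[t_i]$ subject to $t_i^{\nu_i}=1$ for some $\nu_i>1$ ($t_i$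 is an $R$-monomial), the Laurent polynomial ring $A_{i-1}[t_i,t_i^{-1}]$ ($t_i$ is a $\Pi$-monomial), or the polynomial ring $A_{i-1}[t_i]$ ($t_i$ is a $\Sigma$-monomial). Let $E=A_e=F(x)\langle t_1\rangle\cdots\langle t_e\rangle$, and let $\sigma$ extend to an automorphism of $E$ such that every $c\in E$ with $\sigma(c)=c$ lies in $F(x)$, and such that for each $i$: if $t_i$ is an $R$-monomial, then $\sigma(t_i)/t_i\in A_{i-1}^*$ is a primitive $\nu_i$-th root of unity; if $t_i$ is a $\Pi$-monomial, then $\sigma(t_i)/t_i\in A_{i-1}^*$; if $t_i$ is a $\Sigma$-monomial, then $\sigma(t_i)-t_i\in A_{i-1}$. Assume that the extension is simple: for all $R$- and $\Pi$-monomials $t_i$ one has $\sigma(t_i)/t_i=u_i\,t_1^{m_1}\cdots t_{i-1}^{m_{i-1}}$ with $u_i\in F(x)^*$, $m_j\in\mathbb Z$ and $m_j=0$ whenever $t_j$ is a $\Sigma$-monomial, and if $t_i$ is an $R$-monomial, then moreover $u_i$ is a root of unity and $m_j=0$ whenever $t_j$ is a $\Pi$-monomial. Every $a\in E$ is uniquely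 an $F(x)$-linear combination of the power products $t_1^{n_1}\cdots t_e^{n_e}$ with $0\le n_j<\nu_j$ for $R$-monomials, $n_j\in\mathbb Z$ for $\Pi$-monomials and $n_j\ge 0$ for $\Sigma$-monomials; $\operatorname{den}(a)\in F[x]$ is the monic least common multiple of the denominators of its coefficients. For $a\in F[x]\langle t_1\rangle\cdots\langle t_e\rangle$ (all coefficients in $F[x]$), $\deg_x(a)$ is the maximal degree of a coefficient, with $\deg_x(0)=-\infty$. Assume that the extension $E$ of $F(x)$ has $x$-degree $\le d$: $u_i$ has $x$-degree $\le d$ for every $\Pi$-monomial $t_i$, and $\operatorname{den}(\sigma(t_i)-t_i)$ has $x$-degree $\le d$ for every $\Sigma$-monomial $t_i$. **Statement.** Let $\{q_1,\dots,q_r\}\subseteq F[x]$ ($r\ge 0$, the $q_i$ distinct) be a $(d,x)$-set, and let $f,f',g\in E$ with $$\sigma(g)-g+f'=f,\qquad f'=\frac{p_1}{q_1^{n_1}}+\dots+\frac{p_r}{q_r^{n_r}}+\frac pq,$$ where $n_i\ge1$, $q\in F[x]\setminus\{0\}$ has $x$-degree $\le d$, $p,p_1,\dots,p_r\in F[x]\langle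 t_1\rangle\cdots\langle t_e\rangle$, and $\deg_x(p_i)<n_i\deg_x(q_i)$ for all $i$. Then there is an $h\in E$ with $\sigma(h)-h=f$ if and only if $p_1=\dots=p_r=0$ and there is a $g'\in E$ with $\sigma(g')-g'=p/q$. If this is the case, then for every $g'\in E$ with $\sigma(g')-g'=p/q$ the denominator $\operatorname{den}(g')$ has $x$-degree $\le d$, and $h=g+g'$ satisfies $\sigma(h)-h=f$. -/

import Mathlib

open Polynomial

/-! ### The rings `A⟨t₁⟩…⟨tₑ⟩` -/

/-- The three kinds of generators: an `R`-monomial of order `ν`, a `Π`-monomial, a `Σ`-monomial. -/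
inductive MonomialKind : Type
  | root (ν : ℕ) : MonomialKind
  | pi : MonomialKind
  | sigma : MonomialKind

namespace MonomialKind

/-- The exponents of the powers of a generator: the ring `A⟨t⟩` is `A[t]/(t ^ ν - 1)`, whose powers
of `t` are indexed by `ℤ/ν` (that is, by the reduced exponents `0 ≤ n < ν`), or `A[t, t⁻¹]`, with
exponents in `ℤ`, or `A[t]`, with exponents in `ℕ`. -/
def Exponent : MonomialKind → Type
  | root ν => ZMod ν
  | pi => ℤ
  | sigma => ℕ

instance instAddCommMonoidExponent : (k : MonomialKind) → AddCommMonoid k.Exponent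
  | root ν => inferInstanceAs (AddCommMonoid (ZMod ν))
  | pi => inferInstanceAs (AddCommMonoid ℤ)
  | sigma => inferInstanceAs (AddCommMonoid ℕ)

/-- The exponent `1`. -/
def one : (k : MonomialKind) → k.Exponent
  | root ν => (1 : ZMod ν)
  | pi => (1 : ℤ)
  | sigma => (1 : ℕ)

end MonomialKind

/-- The (reduced) exponent vectors `n = (n₁, …, nₑ)` of the power products `t₁ ^ n₁ ⋯ tₑ ^ nₑ`. -/
abbrev ExponentVector {e : ℕ} (kind : Fin e → MonomialKind) : Type :=
  (i : Fin e) → (kind i).Exponent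

/-- The ring `A⟨t₁⟩⟨t₂⟩…⟨tₑ⟩`: the free `A`-module on the reduced power products in `t₁, …, tₑ`,
with the evident multiplication.  See `TowerRing.step` for the description as an iterated
adjunction of one generator at a time. -/
abbrev TowerRing (A : Type*) [CommRing A] {e : ℕ} (kind : Fin e → MonomialKind) : Type _ :=
  AddMonoidAlgebra A (ExponentVector kind)

namespace TowerRing

variable {A : Type*} [CommRing A] {e : ℕ} {kind : Fin e → MonomialKind}

/-- The term `a t₁ ^ m₁ ⋯ tₑ ^ mₑ`. -/
noncomputable def term (m : ExponentVector kind) (a : A) : TowerRing A kind :=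
  AddMonoidAlgebra.single m a

/-- The generator `tᵢ`. -/
noncomputable def gen (A : Type*) [CommRing A] {e : ℕ} (kind : Fin e → MonomialKind) (i : Fin e) :
    TowerRing A kind :=
  term (Pi.single i (kind i).one) 1

/-- `f` lies in the subring `A⟨t₁⟩…⟨tᵢ₋₁⟩` that is built from the generators before `tᵢ`. -/
def InLevel (i : Fin e) (f : TowerRing A kind) : Prop :=
  ∀ m ∈ f.coeff.support, ∀ j, i ≤ j → m j = 0

/-- `A⟨t₁⟩…⟨tₑ₊₁⟩ = (A⟨t₁⟩…⟨tₑ⟩)⟨tₑ₊₁⟩`, where the last adjunction is the monoid algebra over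
`ℤ/ν`, `ℤ` or `ℕ`, that is, `B[t]/(t ^ ν - 1)`, `B[t, t⁻¹]` or `B[t]`. -/
noncomputable def step (A : Type*) [CommRing A] {e : ℕ} (kind : Fin (e + 1) → MonomialKind) :
    TowerRing A kind ≃+*
      AddMonoidAlgebra (TowerRing A fun i : Fin e => kind i.castSucc)
        (kind (Fin.last e)).Exponent :=
  (AddMonoidAlgebra.domCongr A A
    ({ toFun := fun m => (m (Fin.last e), fun i => m i.castSucc)
       invFun := fun p => Fin.snoc (α := fun i => (kind i).Exponent) p.2 p.1
       left_inv := fun m => by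
        funext i
        refine Fin.lastCases ?_ (fun j => ?_) i <;> simp
       right_inv := fun p => by simp
       map_add' := fun _ _ => rfl } :
      ExponentVector kind ≃+
        (kind (Fin.last e)).Exponent × ExponentVector fun i : Fin e => kind i.castSucc)).toRingEquiv.trans
    AddMonoidAlgebra.curryRingEquiv

end TowerRing

/-! ### Difference fields and difference rings -/

/-- `(F(x), σ)` is a `ΠΣ`-field extension of the difference field `(F, τ)`, with the single
generator `x`. -/
structure IsPiSigmaFieldExtension {F : Type*} [Field F] (τ : RingAut F)
    (σ : RingAut (RatFunc F)) : Prop where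
  extends_base : ∀ a : F, σ (RatFunc.C a) = RatFunc.C (τ a)
  monomial : (∃ a : F, a ≠ 0 ∧ σ RatFunc.X / RatFunc.X = RatFunc.C a) ∨
    (∃ a : F, σ RatFunc.X - RatFunc.X = RatFunc.C a)
  const : ∀ r : RatFunc F, σ r = r → ∃ a : F, τ a = a ∧ r = RatFunc.C a

open TowerRing in
/-- `(A⟨t₁⟩…⟨tₑ⟩, σ)` is an `RΠΣ`-extension of the difference ring `(A, σ₀)`. -/
structure IsRPiSigmaExtension {A : Type*} [CommRing A] {e : ℕ} {kind : Fin e → MonomialKind}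
    (σ₀ : RingAut A) (σ : RingAut (TowerRing A kind)) : Prop where
  extends_base : ∀ a : A, σ (algebraMap A (TowerRing A kind) a) = algebraMap A _ (σ₀ a)
  const : ∀ f : TowerRing A kind, σ f = f → ∃ a : A, σ₀ a = a ∧ f = algebraMap A _ a
  root : ∀ i ν, kind i = .root ν → 1 < ν ∧ ∃ α β : TowerRing A kind,
    InLevel i α ∧ InLevel i β ∧ α * β = 1 ∧ IsPrimitiveRoot α ν ∧
      σ (gen A kind i) = α * gen A kind i
  pi : ∀ i, kind i = .pi → ∃ α β : TowerRing A kind,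
    InLevel i α ∧ InLevel i β ∧ α * β = 1 ∧ σ (gen A kind i) = α * gen A kind i
  sigma : ∀ i, kind i = .sigma → InLevel i (σ (gen A kind i) - gen A kind i)

open TowerRing in
/-- The extra condition that makes an `RΠΣ`-extension simple:
`σ(tᵢ) / tᵢ = u t₁ ^ m₁ ⋯ tᵢ₋₁ ^ mᵢ₋₁` with `u ∈ Aˣ` for all `R`- and `Π`-monomials `tᵢ`, where no
`Σ`-monomial occurs on the right, and where for an `R`-monomial `tᵢ` moreover `u` is a root of unity
and no `Π`-monomial occurs. -/
structure IsSimpleExtension {A : Type*} [CommRing A] {e : ℕ} {kind : Fin e → MonomialKind}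
    (σ : RingAut (TowerRing A kind)) : Prop where
  root : ∀ i ν, kind i = .root ν → ∃ (u : A) (m : ExponentVector kind),
    (∃ k : ℕ, 0 < k ∧ u ^ k = 1) ∧ (∀ j, i ≤ j → m j = 0) ∧
    (∀ j, kind j = .pi ∨ kind j = .sigma → m j = 0) ∧
    σ (gen A kind i) = term m u * gen A kind i
  pi : ∀ i, kind i = .pi → ∃ (u : A) (m : ExponentVector kind),
    IsUnit u ∧ (∀ j, i ≤ j → m j = 0) ∧ (∀ j, kind j = .sigma → m j = 0) ∧
    σ (gen A kind i) = term m u * gen A kind i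

/-! ### Periods, shift equivalence, and `x`-degrees -/

section RationalFunctions

variable {F : Type*} [Field F]

/-- The period of `h ∈ F(x)`: the least `n ≥ 1` with `σⁿ(h) / h ∈ F`, and `0` if there is none
(the infimum of the empty set of natural numbers is `0`). -/
noncomputable def period (σ : RingAut (RatFunc F)) (h : RatFunc F) : ℕ :=
  sInf {n : ℕ | 0 < n ∧ ∃ c : F, (σ ^ n) h / h = RatFunc.C c}

/-- `f` and `g` are `σ`-equivalent: `σᵏ(f) / g ∈ F` for some `k ∈ ℤ`. -/
def SigmaEquivalent (σ : RingAut (RatFunc F)) (f g : F[X]) : Prop :=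
  ∃ (k : ℤ) (c : F),
    (σ ^ k) (algebraMap F[X] (RatFunc F) f) / algebraMap F[X] (RatFunc F) g = RatFunc.C c

/-- A nonzero `f ∈ F(x)` has `x`-degree `≤ d`: every irreducible factor of period `0` of its
numerator or denominator has degree at most `d`. -/
def HasXDegreeLE (σ : RingAut (RatFunc F)) (d : ℕ) (f : RatFunc F) : Prop :=
  ∀ h : F[X], Irreducible h → h ∣ f.num ∨ h ∣ f.denom →
    period σ (algebraMap F[X] (RatFunc F) h) = 0 → h.natDegree ≤ d

/-- A `(d, x)`-set: a finite set of monic irreducible polynomials of degree larger than `d` and of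
period `0` that are pairwise `σ`-coprime. -/
structure IsDXSet (σ : RingAut (RatFunc F)) (d : ℕ) (Q : Set F[X]) : Prop where
  finite : Q.Finite
  monic : ∀ q ∈ Q, q.Monic
  irreducible : ∀ q ∈ Q, Irreducible q
  degree : ∀ q ∈ Q, d < q.natDegree
  period_eq_zero : ∀ q ∈ Q, period σ (algebraMap F[X] (RatFunc F) q) = 0
  coprime : ∀ q ∈ Q, ∀ q' ∈ Q, q ≠ q' → ¬ SigmaEquivalent σ q q'

variable {e : ℕ} {kind : Fin e → MonomialKind}

/-- The monic denominator of `f ∈ F(x)⟨t₁⟩…⟨tₑ⟩`: the monic least common multiple of the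
denominators of the coefficients of `f`. -/
noncomputable def den (f : TowerRing (RatFunc F) kind) : F[X] :=
  letI : NormalizedGCDMonoid F[X] := Classical.arbitrary _
  let L : F[X] := f.coeff.support.lcm fun m => (f.coeff m).denom
  Polynomial.C L.leadingCoeff⁻¹ * L

theorem den_monic (f : TowerRing (RatFunc F) kind) : (den f).Monic := by
  unfold den
  letI : NormalizedGCDMonoid F[X] := Classical.arbitrary _
  extract_lets L
  have hL : L ≠ 0 := by
    intro h
    obtain ⟨m, -, hm⟩ := Finset.lcm_eq_zero_iff.mp h
    exact (f.coeff m).denom_ne_zero hm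
  rw [mul_comm]
  exact Polynomial.monic_mul_leadingCoeff_inv hL

theorem den_dvd_iff (f : TowerRing (RatFunc F) kind) (q : F[X]) :
    den f ∣ q ↔ ∀ m, (f.coeff m).denom ∣ q := by
  unfold den
  letI : NormalizedGCDMonoid F[X] := Classical.arbitrary _
  extract_lets L
  have hL : L ≠ 0 := by
    intro h
    obtain ⟨m, -, hm⟩ := Finset.lcm_eq_zero_iff.mp h
    exact (f.coeff m).denom_ne_zero hm
  have hu : IsUnit (Polynomial.C L.leadingCoeff⁻¹) :=
    Polynomial.isUnit_C.mpr (inv_ne_zero (Polynomial.leadingCoeff_ne_zero.mpr hL)).isUnit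
  rw [hu.mul_left_dvd, Finset.lcm_dvd_iff]
  refine ⟨fun h m => ?_, fun h m _ => h m⟩
  by_cases hm : m ∈ f.coeff.support
  · exact h m hm
  · rw [Finsupp.notMem_support_iff.mp hm, RatFunc.denom_zero]
    exact one_dvd q

/-- The inclusion of `F[x]⟨t₁⟩…⟨tₑ⟩` into `F(x)⟨t₁⟩…⟨tₑ⟩`. -/
noncomputable def ofPoly : TowerRing F[X] kind →+* TowerRing (RatFunc F) kind :=
  AddMonoidAlgebra.mapRingHom _ (algebraMap F[X] (RatFunc F))

/-- The degree in `x` of an element of `F[x]⟨t₁⟩…⟨tₑ⟩`, with `⊥` (minus infinity) for `0`. -/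
noncomputable def xDegree (p : TowerRing F[X] kind) : WithBot ℕ :=
  p.coeff.support.sup fun m => (p.coeff m).degree

/-- The fraction `p / q` with `p ∈ F[x]⟨t₁⟩…⟨tₑ⟩` and `q ∈ F[x]`. -/
noncomputable def fraction (p : TowerRing F[X] kind) (q : F[X]) : TowerRing (RatFunc F) kind :=
  (algebraMap F[X] (RatFunc F) q)⁻¹ • ofPoly p

open TowerRing in
/-- An extension `F(x)⟨t₁⟩…⟨tₑ⟩` of `F(x)` has `x`-degree `≤ d`: the factor `u ∈ F(x)ˣ` in
`σ(tᵢ) / tᵢ = u t₁ ^ n₁ ⋯ tᵢ₋₁ ^ nᵢ₋₁`, for each `Π`-monomial, and the denominator of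
`σ(tᵢ) - tᵢ`, for each `Σ`-monomial, have `x`-degree `≤ d`. -/
structure ExtensionHasXDegreeLE (σ₀ : RingAut (RatFunc F)) (d : ℕ)
    (σ : RingAut (TowerRing (RatFunc F) kind)) : Prop where
  pi : ∀ i, kind i = .pi → ∃ (u : RatFunc F) (m : ExponentVector kind),
    u ≠ 0 ∧ (∀ j, i ≤ j → m j = 0) ∧
    σ (gen (RatFunc F) kind i) = term m u * gen (RatFunc F) kind i ∧ HasXDegreeLE σ₀ d u
  sigma : ∀ i, kind i = .sigma →
    HasXDegreeLE σ₀ d (algebraMap F[X] (RatFunc F)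
      (den (σ (gen (RatFunc F) kind i) - gen (RatFunc F) kind i)))

end RationalFunctions

/-! ### Power products and coefficient rings -/

namespace MonomialKind

/-! Call an irreducible polynomial critical if it has period `0` and degree `> d`, and say that `w`
has a pole at `h` if `h ∣ den w`, i.e. some coefficient of `w` is not in the local ring `integersAt`
of `h` (`dvd_den_iff`).

The automorphism of `F(x)` restricts to a degree-preserving automorphism `Φ` of `F[x]`. It permutes
the critical polynomials, and period `0` makes the shifts `Φ ^ k h` pairwise non-associated. The
bound on the extension says that at critical places the data defining `σ(tᵢ)` are integral, with
unit coefficients for `R`- and `Π`-monomials. Hence `σ w` has a pole at `Φ h` exactly when `w` has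
one at `h` (`map_mem_coeffsIn_iff`).

If `w` has poles on the orbit of `h`, let `m ≤ M` be the extreme shifts, which exist because `den w`
has finitely many factors. Then `σ w - w` has poles at the two different shifts `m` and `M + 1`. So
a difference with at most one pole per critical orbit comes from a `w` with none
(`not_dvd_den_of_orbit_poles_eq`).

With `w = h - g` the difference is `f'`, whose critical poles lie among the `qᵢ`, in distinct
orbits. Thus `w`, `σ w` and `f'` have no critical poles, and the degree bound on `pᵢ` forces `pᵢ =
0`. The same argument applied to `p / q` bounds `den g'`. -/

theorem mem_of_one_mem {k : MonomialKind} (M : AddSubmonoid k.Exponent) (h1 : k.one ∈ M)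
    (hneg : k ≠ sigma → ∀ n : k.Exponent, n + k.one = 0 → n ∈ M) (n : k.Exponent) : n ∈ M := by
  cases k with
  | root ν =>
    let M' : AddSubmonoid (ZMod ν) := M
    have h1' : (1 : ZMod ν) ∈ M' := h1
    have hn' : (-1 : ZMod ν) ∈ M' := hneg (by simp) (-1 : ZMod ν) (neg_add_cancel (1 : ZMod ν))
    change ZMod ν at n
    change n ∈ M'
    obtain ⟨z, rfl⟩ := ZMod.intCast_surjective n
    obtain ⟨j, rfl | rfl⟩ := z.eq_nat_or_neg
    · simpa using M'.nsmul_mem h1' j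
    · simpa using M'.nsmul_mem hn' j
  | pi =>
    let M' : AddSubmonoid ℤ := M
    have h1' : (1 : ℤ) ∈ M' := h1
    have hn' : (-1 : ℤ) ∈ M' := hneg (by simp) (-1 : ℤ) (neg_add_cancel (1 : ℤ))
    change ℤ at n
    change n ∈ M'
    obtain ⟨j, rfl | rfl⟩ := n.eq_nat_or_neg
    · simpa using M'.nsmul_mem h1' j
    · simpa using M'.nsmul_mem hn' j
  | sigma =>
    let M' : AddSubmonoid ℕ := M
    have h1' : (1 : ℕ) ∈ M' := h1
    change ℕ at n
    change n ∈ M'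
    simpa using M'.nsmul_mem h1' n

theorem exists_add_eq_zero {k : MonomialKind} (n : k.Exponent) (h : k = sigma → n = 0) :
    ∃ n' : k.Exponent, n + n' = 0 := by
  cases k with
  | root ν =>
    change ZMod ν at n
    exact ⟨(-n : ZMod ν), add_neg_cancel n⟩
  | pi =>
    change ℤ at n
    exact ⟨(-n : ℤ), add_neg_cancel n⟩
  | sigma => exact ⟨0, by rw [h rfl, add_zero]⟩

end MonomialKind

namespace TowerRing

variable {A : Type*} [CommRing A] {e : ℕ} {kind : Fin e → MonomialKind}

theorem term_mul_term (m n : ExponentVector kind) (a b : A) :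
    term m a * term n b = term (m + n) (a * b) :=
  AddMonoidAlgebra.single_mul_single m n a b

theorem term_zero_one : term (0 : ExponentVector kind) (1 : A) = 1 := rfl

theorem term_zero (a : A) :
    term (0 : ExponentVector kind) a = algebraMap A (TowerRing A kind) a := rfl

theorem coeff_algebraMap_mem (O : Subring A) {a : A} (ha : a ∈ O) (m : ExponentVector kind) :
    (algebraMap A (TowerRing A kind) a).coeff m ∈ O := by
  classical
  rw [← term_zero, term, AddMonoidAlgebra.coeff_single, Finsupp.single_apply]
  split_ifs
  exacts [ha, O.zero_mem]

/-- The exponents `n` of a single generator `tᵢ` with `tᵢ ^ n` in a given subring. -/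
def exponentsMem (C : Subring (TowerRing A kind)) (i : Fin e) :
    AddSubmonoid (kind i).Exponent where
  carrier := {n | term (Pi.single i n) 1 ∈ C}
  zero_mem' := by
    simp only [Set.mem_ofPred_eq, Pi.single_zero, term_zero_one]
    exact C.one_mem
  add_mem' {a b} ha hb := by
    have := C.mul_mem ha hb
    rwa [term_mul_term, ← Pi.single_add, mul_one] at this

theorem term_single_mem {C : Subring (TowerRing A kind)} {i : Fin e} (h1 : gen A kind i ∈ C)
    (hneg : kind i ≠ .sigma → ∀ n, n + (kind i).one = 0 → term (Pi.single i n) 1 ∈ C)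
    (n : (kind i).Exponent) : term (Pi.single i n) (1 : A) ∈ C :=
  MonomialKind.mem_of_one_mem (exponentsMem C i) h1 hneg n

theorem term_mem {C : Subring (TowerRing A kind)} {a : A}
    (ha : algebraMap A (TowerRing A kind) a ∈ C) (m : ExponentVector kind)
    (hm : ∀ j, term (Pi.single j (m j)) (1 : A) ∈ C) : term m a ∈ C := by
  have key : term m (1 : A) = ∏ j, term (Pi.single j (m j)) (1 : A) := by
    unfold term
    rw [AddMonoidAlgebra.prod_single, Finset.univ_sum_single, Finset.prod_const_one]
  have : term m a = algebraMap A (TowerRing A kind) a * term m 1 := by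
    rw [← term_zero, term_mul_term, zero_add, mul_one]
  rw [this, key]
  exact C.mul_mem ha (C.prod_mem fun j _ => hm j)

theorem mem_of_coeff_mem {C : Subring (TowerRing A kind)} {w : TowerRing A kind}
    (hw : ∀ m, algebraMap A (TowerRing A kind) (w.coeff m) ∈ C)
    (hm : ∀ m ∈ w.coeff.support, ∀ j, term (Pi.single j (m j)) (1 : A) ∈ C) : w ∈ C := by
  rw [← AddMonoidAlgebra.sum_coeff_single w]
  exact C.sum_mem fun m hms => term_mem (hw m) m (hm m hms)

/-- The elements of `A⟨t₁⟩…⟨tₑ⟩` all of whose coefficients lie in the subring `O` of `A`. -/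
def coeffsIn (kind : Fin e → MonomialKind) (O : Subring A) : Subring (TowerRing A kind) where
  carrier := {w | ∀ m, w.coeff m ∈ O}
  zero_mem' m := by simp
  one_mem' m := by
    rw [← map_one (algebraMap A (TowerRing A kind))]
    exact coeff_algebraMap_mem O O.one_mem m
  add_mem' ha hb m := by
    rw [AddMonoidAlgebra.coeff_add, Finsupp.add_apply]
    exact O.add_mem (ha m) (hb m)
  neg_mem' ha m := by
    rw [AddMonoidAlgebra.coeff_neg, Finsupp.neg_apply]
    exact O.neg_mem (ha m)
  mul_mem' {a b} ha hb m := by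
    classical
    rw [AddMonoidAlgebra.coeff_mul]
    refine O.sum_mem fun m₁ _ => O.sum_mem fun m₂ _ => ?_
    dsimp only
    split_ifs
    exacts [O.mul_mem (ha m₁) (hb m₂), O.zero_mem]

theorem mem_coeffsIn {O : Subring A} {w : TowerRing A kind} :
    w ∈ coeffsIn kind O ↔ ∀ m, w.coeff m ∈ O := Iff.rfl

theorem term_mem_coeffsIn {O : Subring A} {a : A} (ha : a ∈ O) (m : ExponentVector kind) :
    term m a ∈ coeffsIn kind O := by
  classical
  intro m'
  rw [term, AddMonoidAlgebra.coeff_single, Finsupp.single_apply]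
  split_ifs
  exacts [ha, O.zero_mem]

/-- An automorphism that acts on the generators through coefficients in `O`, with units of `O` as
the coefficients for the `R`- and `Π`-monomials. -/
structure IsIntegralOver (σ : RingAut (TowerRing A kind)) (O : Subring A) : Prop where
  unit : ∀ i, kind i ≠ .sigma → ∃ (u v : A) (m m' : ExponentVector kind),
    u ∈ O ∧ v ∈ O ∧ u * v = 1 ∧ m + m' = 0 ∧ (∀ j, i ≤ j → m j = 0) ∧ (∀ j, i ≤ j → m' j = 0) ∧
    σ (gen A kind i) = term m u * gen A kind i
  sigma : ∀ i, kind i = .sigma → InLevel i (σ (gen A kind i) - gen A kind i) ∧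
    σ (gen A kind i) - gen A kind i ∈ coeffsIn kind O

/-- Exponents carry only a monoid structure, so `n + one = 0` is how the exponent `-1` is expressed.
-/
theorem gen_mul_term_neg {i : Fin e} {n : (kind i).Exponent} (hn : n + (kind i).one = 0) :
    gen A kind i * term (Pi.single i n) 1 = 1 := by
  rw [gen, term_mul_term, ← Pi.single_add, add_comm, hn, Pi.single_zero, mul_one, term_zero_one]

theorem map_term_neg {σ : RingAut (TowerRing A kind)} {i : Fin e} {n : (kind i).Exponent}
    (hn : n + (kind i).one = 0) {u v : A} {m m' : ExponentVector kind} (huv : u * v = 1)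
    (hm : m + m' = 0) (hσ : σ (gen A kind i) = term m u * gen A kind i) :
    σ (term (Pi.single i n) 1) = term m' v * term (Pi.single i n) 1 := by
  have h1 := gen_mul_term_neg (A := A) hn
  have h2 : term m u * term m' v = 1 := by rw [term_mul_term, hm, huv, term_zero_one]
  have h3 := congrArg σ h1
  rw [map_mul, map_one, hσ] at h3
  linear_combination (term m' v * term (Pi.single i n) 1) * h3 -
    σ (term (Pi.single i n) 1) * (term m u * term m' v * h1 + h2)

/-- The preimage of `coeffsIn kind O'` under `σ` is a subring, so only constants, generators and
inverses of generators need checking. -/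
theorem map_mem_coeffsIn {σ₀ : RingAut A} {σ : RingAut (TowerRing A kind)}
    (hbase : ∀ a : A, σ (algebraMap A (TowerRing A kind) a) = algebraMap A _ (σ₀ a))
    {O O' : Subring A} (hO : ∀ a ∈ O, σ₀ a ∈ O') (hσ : IsIntegralOver σ O')
    {w : TowerRing A kind} (hw : w ∈ coeffsIn kind O) : σ w ∈ coeffsIn kind O' := by
  have h1 := O'.one_mem
  change w ∈ (coeffsIn kind O').comap (σ : TowerRing A kind →+* TowerRing A kind)
  refine mem_of_coeff_mem (fun m => ?_) fun m _ j => term_single_mem ?_ (fun hj n hn => ?_) _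
  · change σ (algebraMap A _ (w.coeff m)) ∈ coeffsIn kind O'
    rw [hbase]
    exact coeff_algebraMap_mem O' (hO _ (hw m))
  · change σ (gen A kind j) ∈ coeffsIn kind O'
    by_cases hj : kind j = .sigma
    · rw [← sub_add_cancel (σ (gen A kind j)) (gen A kind j)]
      exact Subring.add_mem _ (hσ.sigma j hj).2 (term_mem_coeffsIn h1 _)
    · obtain ⟨u, v, m, m', hu, -, -, -, -, -, h⟩ := hσ.unit j hj
      rw [h]
      exact Subring.mul_mem _ (term_mem_coeffsIn hu _) (term_mem_coeffsIn h1 _)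
  · change σ (term (Pi.single j n) 1) ∈ coeffsIn kind O'
    obtain ⟨u, v, m, m', -, hv, huv, hm, -, -, h⟩ := hσ.unit j hj
    rw [map_term_neg hn huv hm h]
    exact Subring.mul_mem _ (term_mem_coeffsIn hv _) (term_mem_coeffsIn h1 _)

/-- This is the surjectivity half: the relation for `σ(tᵢ)` is solved for `tᵢ` or `tᵢ⁻¹`. The other
factors or summands involve only earlier generators, hence the induction on `i`. -/
theorem term_single_mem_map {σ₀ : RingAut A} {σ : RingAut (TowerRing A kind)}
    (hbase : ∀ a : A, σ (algebraMap A (TowerRing A kind) a) = algebraMap A _ (σ₀ a))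
    {O O' : Subring A} (hO : ∀ a, σ₀ a ∈ O' → a ∈ O) (hσ : IsIntegralOver σ O') (i : Fin e) :
    ∀ n : (kind i).Exponent, term (Pi.single i n) 1 ∈
      (coeffsIn kind O).map (σ : TowerRing A kind →+* TowerRing A kind) := by
  set C := (coeffsIn kind O).map (σ : TowerRing A kind →+* TowerRing A kind) with hC
  have hterm (m : ExponentVector kind) : σ (term m 1) ∈ C :=
    ⟨_, term_mem_coeffsIn O.one_mem m, rfl⟩
  have hconst (a : A) (ha : a ∈ O') : algebraMap A (TowerRing A kind) a ∈ C := by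
    refine ⟨algebraMap A _ (σ₀.symm a), coeff_algebraMap_mem O (hO _ ?_), ?_⟩
    · rwa [RingEquiv.apply_symm_apply]
    · exact (hbase _).trans (by rw [RingEquiv.apply_symm_apply])
  induction i using WellFoundedLT.induction with
  | ind i ih =>
    have hpow (m : ExponentVector kind) (hm : ∀ j, i ≤ j → m j = 0) (j : Fin e) :
        term (Pi.single j (m j)) (1 : A) ∈ C := by
      rcases lt_or_ge j i with hj | hj
      · exact ih j hj _
      · rw [hm j hj, Pi.single_zero, term_zero_one]
        exact C.one_mem
    refine fun n => term_single_mem ?_ (fun hi n hn => ?_) n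
    · by_cases hi : kind i = .sigma
      · obtain ⟨hlev, hmem⟩ := hσ.sigma i hi
        rw [← sub_sub_cancel (σ (gen A kind i)) (gen A kind i)]
        exact C.sub_mem (hterm _)
          (mem_of_coeff_mem (fun m => hconst _ (hmem m)) fun m hm => hpow m (hlev m hm))
      · obtain ⟨u, v, m, m', -, hv, huv, hm, -, hm', h⟩ := hσ.unit i hi
        have : gen A kind i = σ (gen A kind i) * term m' v := by
          rw [h, mul_right_comm, term_mul_term, hm, huv, term_zero_one, one_mul]
        rw [this]
        exact C.mul_mem (hterm _) (term_mem (hconst v hv) m' (hpow m' hm'))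
    · obtain ⟨u, v, m, m', hu, -, huv, hm, hm', -, h⟩ := hσ.unit i hi
      have : term (Pi.single i n) 1 = σ (term (Pi.single i n) 1) * term m u := by
        rw [map_term_neg hn huv hm h, mul_right_comm, mul_comm (term m' v), term_mul_term, hm, huv,
          term_zero_one, one_mul]
      rw [this]
      exact C.mul_mem (hterm _) (term_mem (hconst u hu) m (hpow m hm'))

/-- The image of `coeffsIn kind O` contains all of `coeffsIn kind O'`, and `σ` is injective. -/
theorem mem_coeffsIn_of_map_mem {σ₀ : RingAut A} {σ : RingAut (TowerRing A kind)}
    (hbase : ∀ a : A, σ (algebraMap A (TowerRing A kind) a) = algebraMap A _ (σ₀ a))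
    {O O' : Subring A} (hO : ∀ a, σ₀ a ∈ O' → a ∈ O) (hσ : IsIntegralOver σ O')
    {w : TowerRing A kind} (hw : σ w ∈ coeffsIn kind O') : w ∈ coeffsIn kind O := by
  have : σ w ∈ (coeffsIn kind O).map (σ : TowerRing A kind →+* TowerRing A kind) := by
    refine mem_of_coeff_mem (fun m => ?_) fun m _ j => term_single_mem_map hbase hO hσ j _
    refine ⟨algebraMap A _ (σ₀.symm ((σ w).coeff m)), coeff_algebraMap_mem O (hO _ ?_), ?_⟩
    · rw [RingEquiv.apply_symm_apply]
      exact hw m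
    · exact (hbase _).trans (by rw [RingEquiv.apply_symm_apply])
  obtain ⟨w', hw', h⟩ := this
  exact σ.injective h ▸ hw'

theorem map_mem_coeffsIn_iff {σ₀ : RingAut A} {σ : RingAut (TowerRing A kind)}
    (hbase : ∀ a : A, σ (algebraMap A (TowerRing A kind) a) = algebraMap A _ (σ₀ a))
    {O O' : Subring A} (hO : ∀ a, σ₀ a ∈ O' ↔ a ∈ O) (hσ : IsIntegralOver σ O')
    {w : TowerRing A kind} : σ w ∈ coeffsIn kind O' ↔ w ∈ coeffsIn kind O :=
  ⟨mem_coeffsIn_of_map_mem hbase (fun a => (hO a).1) hσ,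
    map_mem_coeffsIn hbase (fun a => (hO a).2) hσ⟩

end TowerRing

/-! ### Polynomials under the automorphism of `F(x)` -/

section RationalFunctions

variable {F : Type*} [Field F]

/-- The rational functions without a pole at the irreducible polynomial `h`. -/
def integersAt {h : F[X]} (hh : Irreducible h) : Subring (RatFunc F) where
  carrier := {c | ¬ h ∣ c.denom}
  zero_mem' := by
    simpa only [Set.mem_ofPred_eq, RatFunc.denom_zero] using fun H => hh.not_isUnit (isUnit_of_dvd_one H)
  one_mem' := by
    simpa only [Set.mem_ofPred_eq, RatFunc.denom_one] using fun H => hh.not_isUnit (isUnit_of_dvd_one H)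
  add_mem' {a b} ha hb H :=
    (hh.prime.dvd_or_dvd (H.trans (RatFunc.denom_add_dvd a b))).elim ha hb
  mul_mem' {a b} ha hb H :=
    (hh.prime.dvd_or_dvd (H.trans (RatFunc.denom_mul_dvd a b))).elim ha hb
  neg_mem' {a} ha H := by
    have h1 : RatFunc.denom (-a) ∣ a.denom := by
      rw [RatFunc.denom_dvd a.denom_ne_zero]
      exact ⟨-a.num, by rw [map_neg, neg_div, RatFunc.num_div_denom]⟩
    exact ha (H.trans h1)

theorem mem_integersAt {h : F[X]} {hh : Irreducible h} {c : RatFunc F} :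
    c ∈ integersAt hh ↔ ¬ h ∣ c.denom := Iff.rfl

theorem div_mem_integersAt {h : F[X]} (hh : Irreducible h) (a : F[X]) {b : F[X]} (hb : ¬ h ∣ b) :
    algebraMap F[X] (RatFunc F) a / algebraMap F[X] (RatFunc F) b ∈ integersAt hh :=
  fun H => hb (H.trans (RatFunc.denom_div_dvd a b))

theorem inv_mem_integersAt {h : F[X]} (hh : Irreducible h) {c : RatFunc F} (hc : c ≠ 0)
    (h' : ¬ h ∣ c.num) : c⁻¹ ∈ integersAt hh :=
  fun H => h' (H.trans (RatFunc.denom_inv_dvd hc))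

theorem mem_integersAt_of_pow_eq_one {h : F[X]} (hh : Irreducible h) {c : RatFunc F} {k : ℕ}
    (hk : 0 < k) (hc : c ^ k = 1) : c ∈ integersAt hh := by
  intro H
  have h1 : algebraMap F[X] (RatFunc F) (c.num ^ k) = algebraMap F[X] (RatFunc F) (c.denom ^ k) := by
    rw [← RatFunc.num_div_denom c, div_pow, div_eq_one_iff_eq
      (pow_ne_zero _ (RatFunc.algebraMap_ne_zero c.denom_ne_zero))] at hc
    simpa using hc
  have h2 : c.num ^ k = c.denom ^ k := RatFunc.algebraMap_injective F h1
  have h3 : h ∣ c.num :=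
    hh.prime.dvd_of_dvd_pow (h2 ▸ dvd_pow H hk.ne')
  exact hh.not_isUnit ((RatFunc.isCoprime_num_denom c).isUnit_of_dvd' h3 H)

/-- The automorphism `Φ` of `F[X]` is the restriction of the automorphism `σ` of `F(x)`, and it
preserves degrees. -/
structure IsRestriction (σ : RingAut (RatFunc F)) (Φ : RingAut F[X]) : Prop where
  algebraMap : ∀ p, σ (algebraMap F[X] (RatFunc F) p) = algebraMap F[X] (RatFunc F) (Φ p)
  natDegree : ∀ p, (Φ p).natDegree = p.natDegree

namespace IsRestriction

variable {σ : RingAut (RatFunc F)} {Φ : RingAut F[X]}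

theorem one : IsRestriction (1 : RingAut (RatFunc F)) 1 := ⟨fun _ => rfl, fun _ => rfl⟩

theorem mul {σ' : RingAut (RatFunc F)} {Φ' : RingAut F[X]} (h : IsRestriction σ Φ)
    (h' : IsRestriction σ' Φ') : IsRestriction (σ * σ') (Φ * Φ') where
  algebraMap p := by rw [RingAut.mul_apply, RingAut.mul_apply, h'.algebraMap, h.algebraMap]
  natDegree p := by rw [RingAut.mul_apply, h.natDegree, h'.natDegree]

theorem inv (h : IsRestriction σ Φ) : IsRestriction σ⁻¹ Φ⁻¹ where
  algebraMap p := by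
    apply σ.injective
    rw [h.algebraMap, ← RingAut.mul_apply, ← RingAut.mul_apply, mul_inv_cancel, mul_inv_cancel]
    rfl
  natDegree p := by
    rw [← h.natDegree, ← RingAut.mul_apply, mul_inv_cancel]
    rfl

theorem zpow (h : IsRestriction σ Φ) (k : ℤ) : IsRestriction (σ ^ k) (Φ ^ k) := by
  induction k using Int.induction_on with
  | zero => simpa only [zpow_zero] using one
  | succ k ih => simpa only [zpow_add_one] using ih.mul h
  | pred k ih => simpa only [zpow_sub_one] using ih.mul h.inv

theorem map_mem_integersAt (hΦ : IsRestriction σ Φ) {h h' : F[X]} (hh : Irreducible h)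
    (hh' : Irreducible h') (he : Φ h = h') {c : RatFunc F} (hc : c ∈ integersAt hh) :
    σ c ∈ integersAt hh' := by
  subst he
  rw [← RatFunc.num_div_denom c, map_div₀, hΦ.algebraMap, hΦ.algebraMap]
  exact div_mem_integersAt hh' _ fun H => hc ((map_dvd_iff Φ).1 H)

theorem map_mem_integersAt_iff (hΦ : IsRestriction σ Φ) {h h' : F[X]} (hh : Irreducible h)
    (hh' : Irreducible h') (he : Φ h = h') {c : RatFunc F} :
    σ c ∈ integersAt hh' ↔ c ∈ integersAt hh := by
  refine ⟨fun hc => ?_, hΦ.map_mem_integersAt hh hh' he⟩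
  have := hΦ.inv.map_mem_integersAt hh' hh (by rw [← he]; exact Φ.symm_apply_apply h) hc
  rwa [← RingAut.mul_apply, inv_mul_cancel] at this

end IsRestriction

/-- In both cases `σ(x) = a x + b` with `a ≠ 0`, so `Φ` is `τ` on coefficients followed by an affine
substitution. -/
theorem IsPiSigmaFieldExtension.exists_isRestriction {τ : RingAut F} {σ : RingAut (RatFunc F)}
    (hx : IsPiSigmaFieldExtension τ σ) : ∃ Φ, IsRestriction σ Φ := by
  obtain ⟨a, b, ha, hX⟩ : ∃ a b : F, a ≠ 0 ∧
      σ RatFunc.X = RatFunc.C a * RatFunc.X + RatFunc.C b := by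
    rcases hx.monomial with ⟨a, ha, h⟩ | ⟨a, h⟩
    · refine ⟨a, 0, ha, ?_⟩
      rw [← h, div_mul_cancel₀ _ RatFunc.X_ne_zero, map_zero, add_zero]
    · exact ⟨1, a, one_ne_zero, by rw [← h]; simp⟩
  let _ := invertibleOfNonzero ha
  let Φ : RingAut F[X] :=
    (Polynomial.mapEquiv τ).trans (Polynomial.algEquivCMulXAddC a b).toRingEquiv
  have hΦ (p : F[X]) : Φ p = (p.map (τ : F →+* F)).comp (C a * X + C b) := by
    simp [Φ, Polynomial.comp, Polynomial.aeval_def]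
  refine ⟨Φ, fun p => ?_, fun p => ?_⟩
  · have : (σ : RatFunc F →+* RatFunc F).comp (algebraMap F[X] (RatFunc F)) =
        (algebraMap F[X] (RatFunc F)).comp (Φ : F[X] →+* F[X]) := by
      refine Polynomial.ringHom_ext (fun c => ?_) ?_
      · simp [hΦ, hx.extends_base]
      · simp [hΦ, hX]
    exact congrArg (fun f => f p) this
  · rw [hΦ, Polynomial.natDegree_comp, Polynomial.natDegree_linear ha, mul_one,
      Polynomial.natDegree_map]

/-! ### Critical polynomials -/

theorem period_eq_zero_iff {σ : RingAut (RatFunc F)} {h : RatFunc F} :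
    period σ h = 0 ↔ ∀ n : ℕ, 0 < n → ∀ c : F, (σ ^ n) h / h ≠ RatFunc.C c := by
  rw [period, Nat.sInf_eq_zero]
  constructor
  · rintro (⟨h0, -⟩ | h0) n hn c hc
    · exact h0.false
    · exact (h0 ▸ (⟨hn, c, hc⟩ : n ∈ {n : ℕ | 0 < n ∧ ∃ c : F, (σ ^ n) h / h = RatFunc.C c}) :
        n ∈ (∅ : Set ℕ))
  · intro H
    right
    ext n
    simpa using fun hn c => H n hn c

/-- The irreducible polynomials of period `0` and of degree larger than `d`. -/
structure IsCritical (σ : RingAut (RatFunc F)) (d : ℕ) (h : F[X]) : Prop where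
  irreducible : Irreducible h
  degree : d < h.natDegree
  period_eq_zero : period σ (algebraMap F[X] (RatFunc F) h) = 0

theorem HasXDegreeLE.not_dvd {σ : RingAut (RatFunc F)} {d : ℕ} {f : RatFunc F}
    (hf : HasXDegreeLE σ d f) {h : F[X]} (hh : IsCritical σ d h) : ¬ (h ∣ f.num ∨ h ∣ f.denom) :=
  fun H => (hf h hh.irreducible H hh.period_eq_zero).not_gt hh.degree

theorem IsCritical.zpow {σ : RingAut (RatFunc F)} {Φ : RingAut F[X]} {τ : RingAut F}
    (hτ : ∀ a : F, σ (RatFunc.C a) = RatFunc.C (τ a))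
    (hΦ : IsRestriction σ Φ) {d : ℕ} {h : F[X]} (hh : IsCritical σ d h) (k : ℤ) :
    IsCritical σ d ((Φ ^ k) h) where
  irreducible := (MulEquiv.irreducible_iff (Φ ^ k)).2 hh.irreducible
  degree := by
    rw [(hΦ.zpow k).natDegree]
    exact hh.degree
  period_eq_zero := by
    -- Powers of `σ` preserve `F`, so a relation showing a positive period for `Φ ^ k h` can be
    -- pulled back by `σ ^ (-k)` to one for `h`.
    have hτ' (a : F) : ∃ b, (σ ^ (-k)) (RatFunc.C a) = RatFunc.C b := by
      induction k using Int.induction_on generalizing a with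
      | zero => exact ⟨a, rfl⟩
      | succ k ih =>
        obtain ⟨b, hb⟩ := ih (τ⁻¹ a)
        refine ⟨b, ?_⟩
        rw [neg_add, zpow_add, RingAut.mul_apply, ← hb]
        congr 1
        apply σ.injective
        rw [hτ, ← RingAut.mul_apply, ← RingAut.mul_apply]
        simp
      | pred k ih =>
        obtain ⟨b, hb⟩ := ih (τ a)
        refine ⟨b, ?_⟩
        rw [neg_sub, sub_neg_eq_add, add_comm, zpow_add_one, RingAut.mul_apply, hτ]
        simpa using hb
    refine period_eq_zero_iff.2 fun n hn c hc => ?_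
    obtain ⟨b, hb⟩ := hτ' c
    refine period_eq_zero_iff.1 hh.period_eq_zero n hn b ?_
    rw [← hb, ← hc, ← (hΦ.zpow k).algebraMap, map_div₀, ← RingAut.mul_apply, ← RingAut.mul_apply,
      ← RingAut.mul_apply, ← zpow_natCast, ← zpow_add, ← zpow_add, ← zpow_add]
    simp

theorem Associated.exists_C_mul_eq {a b : F[X]} (h : Associated a b) :
    ∃ c : F, b = Polynomial.C c * a := by
  obtain ⟨u, rfl⟩ := h
  obtain ⟨c, -, hc⟩ := Polynomial.isUnit_iff.1 u.isUnit
  exact ⟨c, by rw [hc, mul_comm]⟩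

theorem Associated.sigmaEquivalent {σ : RingAut (RatFunc F)} {Φ : RingAut F[X]}
    (hΦ : IsRestriction σ Φ) {a b : F[X]} (ha : a ≠ 0) {k : ℤ} (h : Associated b ((Φ ^ k) a)) :
    SigmaEquivalent σ a b := by
  obtain ⟨c, hc⟩ := h.exists_C_mul_eq
  have hb : b ≠ 0 := h.ne_zero_iff.2 ((map_ne_zero_iff _ (Φ ^ k).injective).2 ha)
  refine ⟨k, c, ?_⟩
  rw [(hΦ.zpow k).algebraMap, hc, map_mul, mul_div_cancel_right₀ _ (RatFunc.algebraMap_ne_zero hb),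
    RatFunc.algebraMap_C]

theorem IsCritical.eq_zero_of_associated {σ : RingAut (RatFunc F)} {Φ : RingAut F[X]}
    (hΦ : IsRestriction σ Φ) {d : ℕ} {h : F[X]} (hh : IsCritical σ d h) {n : ℕ}
    (hn : Associated h ((Φ ^ n) h)) : n = 0 := by
  by_contra hn0
  obtain ⟨c, hc⟩ := hn.exists_C_mul_eq
  refine period_eq_zero_iff.1 hh.period_eq_zero n (Nat.pos_of_ne_zero hn0) c ?_
  have := (hΦ.zpow n).algebraMap h
  rw [zpow_natCast, zpow_natCast] at this
  rw [this, hc, map_mul,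
    mul_div_cancel_right₀ _ (RatFunc.algebraMap_ne_zero hh.irreducible.ne_zero),
    RatFunc.algebraMap_C]

theorem IsCritical.eq_of_associated {σ : RingAut (RatFunc F)} {Φ : RingAut F[X]} {τ : RingAut F}
    (hτ : ∀ a : F, σ (RatFunc.C a) = RatFunc.C (τ a))
    (hΦ : IsRestriction σ Φ) {d : ℕ} {h : F[X]} (hh : IsCritical σ d h) {k l : ℤ}
    (hkl : Associated ((Φ ^ k) h) ((Φ ^ l) h)) : k = l := by
  wlog hle : k ≤ l generalizing k l
  · exact (this hkl.symm (le_of_not_ge hle)).symm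
  obtain ⟨n, rfl⟩ := Int.le.dest hle
  rw [add_comm, zpow_add, RingAut.mul_apply, zpow_natCast] at hkl
  rw [(hh.zpow hτ hΦ k).eq_zero_of_associated hΦ hkl]
  simp

/-- Distinct shifts are non-associated, hence give distinct normalized irreducible factors of `D`.
-/
theorem IsCritical.finite_dvd {σ : RingAut (RatFunc F)} {Φ : RingAut F[X]} {τ : RingAut F}
    (hτ : ∀ a : F, σ (RatFunc.C a) = RatFunc.C (τ a))
    (hΦ : IsRestriction σ Φ) {d : ℕ} {h : F[X]} (hh : IsCritical σ d h) {D : F[X]} (hD : D ≠ 0) :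
    {k : ℤ | (Φ ^ k) h ∣ D}.Finite := by
  classical
  refine Set.Finite.of_finite_image
    (f := fun k : ℤ => normalize ((Φ ^ k) h))
    ((UniqueFactorizationMonoid.normalizedFactors D).toFinset.finite_toSet.subset ?_) ?_
  · rintro _ ⟨k, hk, rfl⟩
    rw [Finset.mem_coe, Multiset.mem_toFinset, UniqueFactorizationMonoid.mem_normalizedFactors_iff' hD]
    exact ⟨(normalize_associated _).symm.irreducible (hh.zpow hτ hΦ k).irreducible,
      normalize_idem _, normalize_dvd_iff.2 hk⟩
  · intro k _ l _ hkl
    exact hh.eq_of_associated hτ hΦ (normalize_eq_normalize_iff_associated.1 hkl)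

/-! ### Poles of elements of `F(x)⟨t₁⟩…⟨tₑ⟩` -/

open TowerRing

variable {e : ℕ} {kind : Fin e → MonomialKind}

theorem dvd_den_iff {h : F[X]} (hh : Irreducible h) (w : TowerRing (RatFunc F) kind) :
    h ∣ den w ↔ w ∉ coeffsIn kind (integersAt hh) := by
  simp only [mem_coeffsIn, mem_integersAt, not_forall, not_not]
  constructor
  · intro H
    have : den w ∣ ∏ m ∈ w.coeff.support, (w.coeff m).denom := by
      refine (den_dvd_iff w _).2 fun m => ?_
      by_cases hm : m ∈ w.coeff.support
      · exact Finset.dvd_prod_of_mem _ hm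
      · rw [Finsupp.notMem_support_iff.mp hm, RatFunc.denom_zero]
        exact one_dvd _
    obtain ⟨m, -, hm⟩ := (hh.prime.dvd_finsetProd_iff _).1 (H.trans this)
    exact ⟨m, hm⟩
  · rintro ⟨m, hm⟩
    exact hm.trans ((den_dvd_iff w _).1 dvd_rfl m)

theorem coeff_fraction (p : TowerRing F[X] kind) (q : F[X]) (m : ExponentVector kind) :
    (fraction p q).coeff m =
      algebraMap F[X] (RatFunc F) (p.coeff m) / algebraMap F[X] (RatFunc F) q := by
  rw [fraction, ofPoly, AddMonoidAlgebra.coeff_smul_apply, AddMonoidAlgebra.coeff_mapRingHom,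
    smul_eq_mul, div_eq_inv_mul]

theorem fraction_mem_coeffsIn {h : F[X]} (hh : Irreducible h) (p : TowerRing F[X] kind) {q : F[X]}
    (hq : ¬ h ∣ q) : fraction p q ∈ coeffsIn kind (integersAt hh) := fun m => by
  rw [coeff_fraction]
  exact div_mem_integersAt hh _ hq

/-- Integrality at `h` forces `h ^ n` to divide each coefficient of `p`, whose degree is too small
unless it vanishes. -/
theorem eq_zero_of_fraction_mem_coeffsIn {h : F[X]} (hh : Irreducible h)
    {p : TowerRing F[X] kind} {n : ℕ}
    (hp : xDegree p < ((h.natDegree * n : ℕ) : WithBot ℕ))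
    (hmem : fraction p (h ^ n) ∈ coeffsIn kind (integersAt hh)) : p = 0 := by
  rw [← AddMonoidAlgebra.coeff_eq_zero]
  ext1 m
  by_contra hm
  change p.coeff m ≠ 0 at hm
  have h1 := hmem m
  rw [coeff_fraction, mem_integersAt] at h1
  set c := algebraMap F[X] (RatFunc F) (p.coeff m) / algebraMap F[X] (RatFunc F) (h ^ n) with hc
  have h2 : c.num * h ^ n = p.coeff m * c.denom :=
    (RatFunc.num_mul_eq_mul_denom_iff (pow_ne_zero n hh.ne_zero)).2 hc
  have h3 : h ^ n ∣ p.coeff m := by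
    refine IsCoprime.dvd_of_dvd_mul_right (IsCoprime.pow_left ?_) (Dvd.intro_left _ h2)
    exact (hh.coprime_iff_not_dvd).2 h1
  have h4 := Polynomial.degree_le_of_dvd h3 hm
  have h5 : (p.coeff m).degree ≤ xDegree p :=
    Finset.le_sup (f := fun m => (p.coeff m).degree) (Finsupp.mem_support_iff.2 hm)
  refine (h4.trans h5).not_gt (hp.trans_eq ?_)
  rw [Polynomial.degree_eq_natDegree (pow_ne_zero _ hh.ne_zero), Polynomial.natDegree_pow, mul_comm]

/-- Simplicity and the degree bound each supply their own `u` and `m` for a `Π`-monomial; this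
identifies them. -/
theorem eq_of_term_mul_gen_eq {i : Fin e} {m m' : ExponentVector kind} {u u' : RatFunc F}
    (hu : u ≠ 0) (hm : ∀ j, i ≤ j → m j = 0) (hm' : ∀ j, i ≤ j → m' j = 0)
    (h : term m u * gen (RatFunc F) kind i = term m' u' * gen (RatFunc F) kind i) :
    m = m' ∧ u = u' := by
  rw [gen, term_mul_term, term_mul_term, mul_one, mul_one, term, term,
    AddMonoidAlgebra.single_inj] at h
  rcases h with ⟨h1, h2⟩ | ⟨h1, -⟩
  · refine ⟨funext fun j => ?_, h2⟩
    rcases lt_or_ge j i with hj | hj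
    · have := congrFun h1 j
      rwa [Pi.add_apply, Pi.add_apply, Pi.single_eq_of_ne hj.ne, add_zero, add_zero] at this
    · rw [hm j hj, hm' j hj]
  · exact absurd h1 hu

theorem exists_neg_exponentVector {i : Fin e} {m : ExponentVector kind}
    (hm : ∀ j, i ≤ j → m j = 0) (hs : ∀ j, kind j = .sigma → m j = 0) :
    ∃ m' : ExponentVector kind, m + m' = 0 ∧ ∀ j, i ≤ j → m' j = 0 := by
  choose m' hm' using fun j => MonomialKind.exists_add_eq_zero (m j) (hs j)
  refine ⟨m', funext hm', fun j hj => ?_⟩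
  have := hm' j
  rwa [hm j hj, zero_add] at this

/-- Roots of unity have no poles, and a critical `h` divides neither numerator nor denominator of
`u` for a `Π`-monomial. Simplicity excludes `Σ`-monomials from `m`, so the power product is
invertible. -/
theorem ExtensionHasXDegreeLE.isIntegralOver {σ₀ : RingAut (RatFunc F)}
    {σ : RingAut (TowerRing (RatFunc F) kind)} {d : ℕ} (hd : ExtensionHasXDegreeLE σ₀ d σ)
    (hE : IsRPiSigmaExtension σ₀ σ) (hsimple : IsSimpleExtension σ) {h : F[X]}
    (hh : IsCritical σ₀ d h) : IsIntegralOver σ (integersAt hh.irreducible) where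
  unit i hi := by
    cases hk : kind i with
    | root ν =>
      obtain ⟨u, m, ⟨k, hk0, huk⟩, hm, hs, hσ⟩ := hsimple.root i ν hk
      obtain ⟨m', hmm, hm'⟩ := exists_neg_exponentVector hm fun j hj => hs j (Or.inr hj)
      have hu := mem_integersAt_of_pow_eq_one hh.irreducible hk0 huk
      refine ⟨u, u ^ (k - 1), m, m', hu, Subring.pow_mem _ hu _, ?_, hmm, hm, hm', hσ⟩
      rw [mul_pow_sub_one hk0.ne', huk]
    | pi =>
      obtain ⟨u, m, hu, hm, hσ, hdeg⟩ := hd.pi i hk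
      obtain ⟨u', m₁, -, hm₁, hs, hσ'⟩ := hsimple.pi i hk
      obtain ⟨rfl, -⟩ := eq_of_term_mul_gen_eq hu hm hm₁ (hσ.symm.trans hσ')
      obtain ⟨m', hmm, hm'⟩ := exists_neg_exponentVector hm hs
      have hnd := not_or.1 (hdeg.not_dvd hh)
      exact ⟨u, u⁻¹, m, m', hnd.2, inv_mem_integersAt _ hu hnd.1, mul_inv_cancel₀ hu, hmm, hm, hm',
        hσ⟩
    | sigma => exact absurd hk hi
  sigma i hi := by
    refine ⟨hE.sigma i hi, not_not.1 fun H => ?_⟩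
    refine (hd.sigma i hi).not_dvd hh (Or.inl ?_)
    rw [RatFunc.num_algebraMap]
    exact (dvd_den_iff hh.irreducible _).2 H

/-- If `σ(w) - w` has a pole at no more than one member of each orbit of critical polynomials, then
`w` has no poles at critical polynomials. -/
theorem not_dvd_den_of_orbit_poles_eq {τ : RingAut F} {σ₀ : RingAut (RatFunc F)}
    (hx : IsPiSigmaFieldExtension τ σ₀) {σ : RingAut (TowerRing (RatFunc F) kind)}
    (hE : IsRPiSigmaExtension σ₀ σ) (hsimple : IsSimpleExtension σ)
    {d : ℕ} (hd : ExtensionHasXDegreeLE σ₀ d σ) {Φ : RingAut F[X]} (hΦ : IsRestriction σ₀ Φ)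
    {w : TowerRing (RatFunc F) kind} {h : F[X]} (hh : IsCritical σ₀ d h)
    (hpole : ∀ k l : ℤ, (Φ ^ k) h ∣ den (σ w - w) → (Φ ^ l) h ∣ den (σ w - w) → k = l) :
    ¬ h ∣ den w := by
  have hirr (k : ℤ) := (hh.zpow hx.extends_base hΦ k).irreducible
  have hshift (k : ℤ) : (Φ ^ (k + 1)) h ∣ den (σ w) ↔ (Φ ^ k) h ∣ den w := by
    rw [dvd_den_iff (hirr _), dvd_den_iff (hirr _), not_iff_not]
    refine map_mem_coeffsIn_iff hE.extends_base (fun a => ?_)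
      (hd.isIntegralOver hE hsimple (hh.zpow hx.extends_base hΦ (k + 1)))
    refine hΦ.map_mem_integersAt_iff (hirr k) (hirr (k + 1)) ?_
    rw [add_comm, zpow_add, zpow_one, RingAut.mul_apply]
  intro h0
  have hfin := hh.finite_dvd hx.extends_base hΦ (den_monic w).ne_zero
  have hne : {k : ℤ | (Φ ^ k) h ∣ den w}.Nonempty := ⟨0, by simpa using h0⟩
  obtain ⟨M, hM, hmax⟩ := hfin.exists_maximal hne
  obtain ⟨m, hm, hmin⟩ := hfin.exists_minimal hne
  -- The top pole of `w` moves up to `M + 1` in `σ w`, where `w` itself is regular by maximality.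
  have h1 : (Φ ^ (M + 1)) h ∣ den (σ w - w) := by
    have a1 : (Φ ^ (M + 1)) h ∣ den (σ w) := (hshift M).2 hM
    have a2 : ¬ (Φ ^ (M + 1)) h ∣ den w := fun H => by
      have := hmax H (by lia)
      lia
    rw [dvd_den_iff (hirr _)] at a1 a2 ⊢
    intro H
    exact a1 (by simpa using Subring.add_mem _ H (not_not.1 a2))
  -- A pole of `σ w` at `m` would come from a pole of `w` at `m - 1`, so nothing cancels the lowest
  -- pole of `w`.
  have h2 : (Φ ^ m) h ∣ den (σ w - w) := by
    have a1 : ¬ (Φ ^ m) h ∣ den (σ w) := fun H => by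
      have H' : (Φ ^ (m - 1)) h ∣ den w := (hshift (m - 1)).1 (by rwa [sub_add_cancel])
      have := hmin H' (by lia)
      lia
    have a2 : (Φ ^ m) h ∣ den w := hm
    rw [dvd_den_iff (hirr _)] at a1 a2 ⊢
    intro H
    exact a2 (by simpa using Subring.sub_mem _ (not_not.1 a1) H)
  have h3 := hpole _ _ h1 h2
  have h4 := hmin hM
  lia

end RationalFunctions

/-! ### The reduction theorem -/

open TowerRing in
theorem mainTheorem4 {F : Type*} [Field F] [CharZero F]
    (τ : RingAut F) (σ₀ : RingAut (RatFunc F)) (hx : IsPiSigmaFieldExtension τ σ₀)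
    {e : ℕ} (kind : Fin e → MonomialKind) (σ : RingAut (TowerRing (RatFunc F) kind))
    (hE : IsRPiSigmaExtension σ₀ σ) (hsimple : IsSimpleExtension σ)
    (d : ℕ) (hd : ExtensionHasXDegreeLE σ₀ d σ)
    {r : ℕ} (q : Fin r → F[X]) (hq_inj : Function.Injective q)
    (hQ : IsDXSet σ₀ d (Set.range q))
    (f f' g : TowerRing (RatFunc F) kind) (hfg : σ g - g + f' = f)
    (n : Fin r → ℕ) (hn : ∀ i, 1 ≤ n i)
    (q₀ : F[X]) (hq₀ : q₀ ≠ 0)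
    (hq₀d : HasXDegreeLE σ₀ d (algebraMap F[X] (RatFunc F) q₀))
    (p₀ : TowerRing F[X] kind) (p : Fin r → TowerRing F[X] kind)
    (hp : ∀ i, xDegree (p i) < (((q i).natDegree * n i : ℕ) : WithBot ℕ))
    (hf' : f' = (∑ i, fraction (p i) (q i ^ n i)) + fraction p₀ q₀) :
    ((∃ h, σ h - h = f) ↔
      (∀ i, p i = 0) ∧ ∃ g', σ g' - g' = fraction p₀ q₀) ∧
    ((∃ h, σ h - h = f) →
      ∀ g', σ g' - g' = fraction p₀ q₀ →
        HasXDegreeLE σ₀ d (algebraMap F[X] (RatFunc F) (den g')) ∧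
        σ (g + g') - (g + g') = f) := by
  obtain ⟨Φ, hΦ⟩ := hx.exists_isRestriction
  have hqc (i : Fin r) : IsCritical σ₀ d (q i) :=
    ⟨hQ.irreducible _ ⟨i, rfl⟩, hQ.degree _ ⟨i, rfl⟩, hQ.period_eq_zero _ ⟨i, rfl⟩⟩
  have hq₀c {h : F[X]} (hh : IsCritical σ₀ d h) : ¬ h ∣ q₀ := fun H =>
    hq₀d.not_dvd hh (Or.inl (by rwa [RatFunc.num_algebraMap]))
  have hp₀c {h : F[X]} (hh : IsCritical σ₀ d h) :
      fraction p₀ q₀ ∈ coeffsIn kind (integersAt hh.irreducible) :=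
    fraction_mem_coeffsIn _ _ (hq₀c hh)
  have hpole {h : F[X]} (hh : IsCritical σ₀ d h) (H : h ∣ den f') :
      ∃ i, Associated h (q i) := by
    by_contra hna
    refine (dvd_den_iff hh.irreducible _).1 H ?_
    rw [hf']
    refine Subring.add_mem _ (Subring.sum_mem _ fun i _ => fraction_mem_coeffsIn _ _ fun hi => ?_)
      (hp₀c hh)
    exact hna ⟨i, hh.irreducible.associated_of_dvd (hqc i).irreducible
      (hh.irreducible.prime.dvd_of_dvd_pow hi)⟩
  have hpoles {h : F[X]} (hh : IsCritical σ₀ d h) (k l : ℤ) (hk : (Φ ^ k) h ∣ den f')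
      (hl : (Φ ^ l) h ∣ den f') : k = l := by
    obtain ⟨i, hi⟩ := hpole (hh.zpow hx.extends_base hΦ k) hk
    obtain ⟨j, hj⟩ := hpole (hh.zpow hx.extends_base hΦ l) hl
    -- Two poles on one orbit make `q i` and `q j` shift equivalent, so they coincide; period `0`
    -- then gives `k = l`.
    have hij : Associated (q j) ((Φ ^ (l - k)) (q i)) := by
      have := hi.map (Φ ^ (l - k))
      rw [← RingAut.mul_apply, ← zpow_add, sub_add_cancel] at this
      exact hj.symm.trans this
    have hqij : q i = q j := by
      by_contra hne
      exact hQ.coprime _ ⟨i, rfl⟩ _ ⟨j, rfl⟩ hne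
        (hij.sigmaEquivalent hΦ (hqc i).irreducible.ne_zero)
    exact hh.eq_of_associated hx.extends_base hΦ (hi.trans (hqij ▸ hj.symm))
  have hregular {w : TowerRing (RatFunc F) kind} (hw : σ w - w = fraction p₀ q₀) :
      HasXDegreeLE σ₀ d (algebraMap F[X] (RatFunc F) (den w)) := by
    intro h hirr hdvd hper
    by_contra hlt
    have hh : IsCritical σ₀ d h := ⟨hirr, not_le.1 hlt, hper⟩
    rw [RatFunc.num_algebraMap, RatFunc.denom_algebraMap] at hdvd
    refine not_dvd_den_of_orbit_poles_eq hx hE hsimple hd hΦ hh (w := w) (fun k l hk => ?_)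
      (hdvd.resolve_right fun H => hirr.not_isUnit (isUnit_of_dvd_one H))
    have hhk := hh.zpow hx.extends_base hΦ k
    rw [hw, dvd_den_iff hhk.irreducible] at hk
    exact absurd (hp₀c hhk) hk
  have hzero {w : TowerRing (RatFunc F) kind} (hw : σ w - w = f') (i : Fin r) : p i = 0 := by
    have hi := (hqc i).irreducible
    have hreg {h : F[X]} (hh : IsCritical σ₀ d h) : ¬ h ∣ den w :=
      not_dvd_den_of_orbit_poles_eq hx hE hsimple hd hΦ hh (by rw [hw]; exact hpoles hh)
    have hreg' : σ w ∈ coeffsIn kind (integersAt hi) := by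
      -- `σ w` is regular at `q i` because `w` is regular at the preceding shift `Φ⁻¹ (q i)`.
      have hh := (hqc i).zpow hx.extends_base hΦ (-1)
      refine (map_mem_coeffsIn_iff hE.extends_base
        (fun a => hΦ.map_mem_integersAt_iff hh.irreducible hi ?_)
        (hd.isIntegralOver hE hsimple (hqc i))).2 ?_
      · rw [← RingAut.mul_apply, ← zpow_one_add]
        rfl
      · exact not_not.1 fun H => hreg hh ((dvd_den_iff hh.irreducible _).2 H)
    have hmem : f' ∈ coeffsIn kind (integersAt hi) := by
      rw [← hw]
      exact Subring.sub_mem _ hreg' (not_not.1 fun H => hreg (hqc i) ((dvd_den_iff hi _).2 H))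
    refine eq_zero_of_fraction_mem_coeffsIn hi (hp i) ?_
    -- Every other term of `f'` is regular at `q i`, which isolates the `i`-th fraction.
    have hsum : fraction (p i) (q i ^ n i) =
        f' - fraction p₀ q₀ - ∑ j ∈ Finset.univ.erase i, fraction (p j) (q j ^ n j) := by
      rw [hf', add_sub_cancel_right, ← Finset.add_sum_erase _ _ (Finset.mem_univ i),
        add_sub_cancel_right]
    rw [hsum]
    refine Subring.sub_mem _ (Subring.sub_mem _ hmem (hp₀c (hqc i))) (Subring.sum_mem _ fun j hj => ?_)
    refine fraction_mem_coeffsIn _ _ fun H => (Finset.ne_of_mem_erase hj) (hq_inj ?_)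
    exact (Polynomial.eq_of_monic_of_associated (hQ.monic _ ⟨i, rfl⟩) (hQ.monic _ ⟨j, rfl⟩)
      (hi.associated_of_dvd (hqc j).irreducible (hi.prime.dvd_of_dvd_pow H))).symm
  have hf'0 (h0 : ∀ i, p i = 0) : f' = fraction p₀ q₀ := by
    simp [hf', h0, fraction]
  have hsub {h : TowerRing (RatFunc F) kind} (hh : σ h - h = f) : σ (h - g) - (h - g) = f' := by
    rw [map_sub]
    linear_combination hh - hfg
  have hadd (h0 : ∀ i, p i = 0) {g' : TowerRing (RatFunc F) kind}
      (hg' : σ g' - g' = fraction p₀ q₀) : σ (g + g') - (g + g') = f := by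
    rw [map_add]
    linear_combination hfg + hg' - hf'0 h0
  refine ⟨⟨fun ⟨h, hh⟩ => ?_, fun ⟨h0, g', hg'⟩ => ⟨g + g', hadd h0 hg'⟩⟩, fun ⟨h, hh⟩ g' hg' => ?_⟩
  · have h0 := hzero (hsub hh)
    exact ⟨h0, h - g, (hsub hh).trans (hf'0 h0)⟩
  · exact ⟨hregular hg', hadd (hzero (hsub hh)) hg'⟩
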